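/- **Theorem 1 (Sufficient conditions).** For $\beta^*\in\mathbb{R}^p$ let $S=\{i:\beta^*_i\neq 0\}$, $s=|S|\ge 1$ and $M(\beta^*)=\min_{i\in S}|\beta^*_i|$. One observes $X$ and $Y=X\beta^*+W\in\mathbb{R}^n$, where the entries of $X\in\mathbb{R}^{n\times p}$ and of $W\in\mathbb{R}^n$ are all independent $N(0,1)$ variables. The optimal decoder $\phi_{\mathrm{opt}}$ returns a subset $U\subseteq\{1,\dots,p\}$ with $|U|=s$ that minimizes $\min_{\theta\in\mathbb{R}^U}\|Y-X_U\theta\|_2^2$, where $X_U$ consists of the columns of $X$ indexed by $U$ (ties are broken arbitrarily). For every $\alpha\in(0,1)$ there is a constant $C>0$, depending only on $\alpha$, such that the following holds for every sequence of triplets $(n,p,s)$ with $n\to\infty$ and $1\le s\le\alpha p$, and every sequence of numbers $M>0$. Suppose that $(n-s)M^2\to+\infty$ and that, for all sufficiently large indices of the sequence, $$ n \;>\; C\,\max\Big\{ s\log\frac{p}{s},\ \frac{1}{M^2}\log(p-s)\Big\}. $$ Then recovery by $\phi_{\mathrm{opt}}$ is asymptotically reliable, in the following two senses. 1. For every sequence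 of fixed vectors $\beta^*\in\mathbb{R}^p$ with support $S$ of size $s$ and $M(\beta^*)\ge M$ (for instance $M=M(\beta^*)$), $\mathbb{P}[\phi_{\mathrm{opt}}(Y)\neq S]\to 0$. 2. The average error probability $$ p_{\mathrm{err}}(\phi_{\mathrm{opt}})=\binom{p}{s}^{-1}\sum_{|S|=s}\mathbb{P}[\phi_{\mathrm{opt}}(Y)\neq S\mid S] $$ tends to $0$, where given $S$ the vector $\beta^*$ is independent of $(X,W)$ and is drawn from an arbitrary probability law under which almost surely its support is $S$ and $M(\beta^*)\ge M$. -/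

import Mathlib

open MeasureTheory ProbabilityTheory Filter Topology

namespace SparsityRecovery

/-- The support `S` of a vector `β ∈ ℝᵖ`. -/
noncomputable def supp {p : ℕ} (β : Fin p → ℝ) : Finset (Fin p) :=
  Finset.univ.filter fun i => β i ≠ 0

/-- `M(β)`: the minimum of `|β i|` over the support of `β` (used for nonzero `β` only). -/
noncomputable def minAbs {p : ℕ} (β : Fin p → ℝ) : ℝ :=
  ⨅ i : {i : Fin p // β i ≠ 0}, |β i|

/-- The noisy linear observations `Y = X β + W`. -/
def observe {n p : ℕ} (X : Fin n → Fin p → ℝ) (β : Fin p → ℝ) (W : Fin n → ℝ) : Fin n → ℝ :=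
  fun i => ∑ j, X i j * β j + W i

/-- The least-squares error `min_θ ‖Y - X_U θ‖₂²` over coefficient vectors `θ ∈ ℝᵁ`. -/
noncomputable def lsError {n p : ℕ} (X : Fin n → Fin p → ℝ) (Y : Fin n → ℝ)
    (U : Finset (Fin p)) : ℝ :=
  ⨅ θ : U → ℝ, ∑ i, (Y i - ∑ j : U, X i j * θ j) ^ 2

/-- A decoder estimates a subset from the measurement matrix and the observations. -/
abbrev Decoder (n p : ℕ) : Type :=
  (Fin n → Fin p → ℝ) → (Fin n → ℝ) → Finset (Fin p)

/-- `φ` selects a subset of size `s` with the smallest least-squares error among all subsets of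
size `s` (with any rule for breaking ties). -/
def IsOptimalDecoder {n p : ℕ} (s : ℕ) (φ : Decoder n p) : Prop :=
  ∀ X Y, (φ X Y).card = s ∧
    ∀ U : Finset (Fin p), U.card = s → lsError X Y (φ X Y) ≤ lsError X Y U

/-- The joint law of the measurement matrix `X` and the noise `W`: all entries of `X` and of `W`
are independent standard Gaussian variables. -/
noncomputable def ensemble (n p : ℕ) : Measure ((Fin n → Fin p → ℝ) × (Fin n → ℝ)) :=
  (Measure.pi fun _ : Fin n => Measure.pi fun _ : Fin p => gaussianReal 0 1).prod
    (Measure.pi fun _ : Fin n => gaussianReal 0 1)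

/-- `P[φ(Y) ≠ S]` for a fixed vector `β` with support `S`. -/
noncomputable def errorProb {n p : ℕ} (φ : Decoder n p) (β : Fin p → ℝ) : ℝ :=
  (ensemble n p).real {q | φ q.1 (observe q.1 β q.2) ≠ supp β}

/-- `P[φ(Y) ≠ S | S]` when the vector on the fixed support `S` is itself drawn from the law `ν`,
independently of the measurement matrix and of the noise. -/
noncomputable def condErrorProb {n p : ℕ} (φ : Decoder n p) (S : Finset (Fin p))
    (ν : Measure (Fin p → ℝ)) : ℝ :=
  (ν.prod (ensemble n p)).real {q | φ q.2.1 (observe q.2.1 q.1 q.2.2) ≠ S}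

/-- The average error probability `p_err(φ)`: the support `S` is uniform over the subsets of
size `s`, and given `S` the vector has law `ν S`. -/
noncomputable def avgErrorProb {n p : ℕ} (s : ℕ) (φ : Decoder n p)
    (ν : Finset (Fin p) → Measure (Fin p → ℝ)) : ℝ :=
  (1 / (p.choose s : ℝ)) *
    ∑ S ∈ Finset.powersetCard s (Finset.univ : Finset (Fin p)), condErrorProb φ S (ν S)

end SparsityRecovery

/-!
Suppose that a wrong set `U` of size `s` fits the observations at least as well as the true support
`S`, and let `k` be the size of `S \ U`. Project onto the spans of the columns indexed by `U`, `S`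
and `S ∪ U`. By Pythagoras, the signal can only lose against the noise in one of three ways
(`norm_sq_sub_starProjection_le_of_fit`): the signal `X β` is unusually close to the span of the
columns in `U`, or the noise has a large component in the orthogonal complement of the span of `U`
in that of `S ∪ U`, or in the complement of the span of `S`.

Given `X`, each of these complements has dimension at most `k`, so the noise components have
chi-squared upper tails. The part of the signal outside `U` is a Gaussian vector, with variance
`∑ β j ^ 2 ≥ k M²` over `S \ U`, and it is independent of the columns in `U`; hence its distance
to their span has a chi-squared lower tail with at least `n - s ≥ n / 2` degrees of freedom. With
the threshold between the two at a multiple of `n ∑ β j ^ 2` the probability that `U` wins is at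
most `exp (-n / 4) + 2 q ^ k`, where `q = 2 exp (-n M² / 256)` (`measureReal_fitEvent_le`).

Summing over `U`, the first term contributes `p.choose s * exp (-n / 4)`. In the second,
`q ^ k = √q ^ (2 k)` and `2 k` is the size of `S ∆ U`, so the sum is at most `(1 + √q) ^ p - 1`
(`sum_pow_card_sdiff_le`). As `s ≤ α p`, the quantities `log (p.choose s)` and `log p` are controlled
by `s log (p / s)` and by `log (p - s)` plus a constant, so that for a large constant `C` the
sample-size condition makes both contributions tend to zero (`errorBound_le_of_sample_size`). The
bound holds for every vector with support `S` and entries at least `M`, so it passes to random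
vectors and to the average over `S`.
-/

namespace SparsityRecovery

/-! ### Chi-squared tails of projected Gaussian vectors -/

lemma integrable_exp_mul_sq_gaussianReal {l : ℝ} (hl : l < 1 / 2) :
    Integrable (fun x : ℝ => Real.exp (l * x ^ 2)) (gaussianReal 0 1) := by
  rw [gaussianReal_of_var_ne_zero _ one_ne_zero, integrable_withDensity_iff (by fun_prop)
    (ae_of_all _ fun x => gaussianPDF_lt_top)]
  have h := (integrable_exp_neg_mul_sq (b := 1 / 2 - l) (by linarith)).const_mul
    (√(2 * Real.pi))⁻¹
  refine h.congr (ae_of_all _ fun x => ?_)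
  simp only [toReal_gaussianPDF, gaussianPDFReal, NNReal.coe_one, mul_one, sub_zero]
  rw [mul_left_comm, ← Real.exp_add]
  congr 2; ring

lemma integral_exp_mul_sq_gaussianReal {l : ℝ} (hl : l < 1 / 2) :
    ∫ x : ℝ, Real.exp (l * x ^ 2) ∂(gaussianReal 0 1) = (√(1 - 2 * l))⁻¹ := by
  rw [integral_gaussianReal_eq_integral_smul one_ne_zero]
  have h : ∀ x : ℝ, gaussianPDFReal 0 1 x • Real.exp (l * x ^ 2)
      = (√(2 * Real.pi))⁻¹ * Real.exp (-(1 / 2 - l) * x ^ 2) := by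
    intro x
    simp only [gaussianPDFReal, NNReal.coe_one, mul_one, sub_zero, smul_eq_mul]
    rw [mul_assoc, ← Real.exp_add]
    congr 2; ring
  simp_rw [h]
  rw [integral_const_mul, integral_gaussian, ← Real.sqrt_inv, ← Real.sqrt_inv,
    ← Real.sqrt_mul (by positivity)]
  congr 1
  have : (1 / 2 - l) ≠ 0 := by linarith
  have : (1 - 2 * l) ≠ 0 := by linarith
  field_simp

lemma norm_sq_sum_smul_orthonormalBasis {E κ : Type*} [NormedAddCommGroup E]
    [InnerProductSpace ℝ E] [Fintype κ] (b : OrthonormalBasis κ ℝ E) (x : κ → ℝ) :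
    ‖∑ i, x i • b i‖ ^ 2 = ∑ i, x i ^ 2 := by
  rw [← real_inner_self_eq_norm_sq, b.orthonormal.inner_sum]
  simp [sq]

section
variable {E : Type*} [NormedAddCommGroup E] [InnerProductSpace ℝ E] [FiniteDimensional ℝ E]
  [MeasurableSpace E] [BorelSpace E]

lemma integrable_exp_mul_norm_sq_stdGaussian {l : ℝ} (hl : l < 1 / 2) :
    Integrable (fun x : E => Real.exp (l * ‖x‖ ^ 2)) (stdGaussian E) := by
  rw [stdGaussian, integrable_map_measure (by fun_prop) (Measurable.aemeasurable (by fun_prop))]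
  refine (Integrable.fintype_prod (f := fun _ x => Real.exp (l * x ^ 2))
    fun _ : Fin (Module.finrank ℝ E) => integrable_exp_mul_sq_gaussianReal hl).congr
    (ae_of_all _ fun x => ?_)
  simp [← Real.exp_sum, ← Finset.mul_sum, norm_sq_sum_smul_orthonormalBasis]

/-- The moment generating function of a chi-squared variable with `finrank ℝ E` degrees of
freedom. -/
lemma mgf_norm_sq_stdGaussian {l : ℝ} (hl : l < 1 / 2) :
    mgf (fun x : E => ‖x‖ ^ 2) (stdGaussian E) l
      = (√(1 - 2 * l))⁻¹ ^ Module.finrank ℝ E := by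
  rw [mgf, stdGaussian, integral_map (Measurable.aemeasurable (by fun_prop)) (by fun_prop)]
  have h := integral_fintype_prod_eq_prod (μ := fun _ : Fin (Module.finrank ℝ E) =>
    gaussianReal 0 1) (fun _ x => Real.exp (l * x ^ 2))
  simp only [integral_exp_mul_sq_gaussianReal hl, Finset.prod_const, Finset.card_univ,
    Fintype.card_fin] at h
  rw [← h]
  congr 1; ext x
  simp [← Real.exp_sum, ← Finset.mul_sum, norm_sq_sum_smul_orthonormalBasis]

lemma stdGaussian_map_orthogonalProjectionOnto (V : Submodule ℝ E) :
    (stdGaussian E).map V.orthogonalProjectionOnto = stdGaussian V := by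
  apply Measure.ext_of_charFun
  ext t
  rw [charFun_stdGaussian, charFun_apply, integral_map (by fun_prop) (by fun_prop)]
  have := charFun_stdGaussian (t : E)
  rw [charFun_apply] at this
  simpa using this

end

section
variable {ι : Type*} [Fintype ι]

lemma measurePreserving_orthogonalProjectionOnto_toLp
    (V : Submodule ℝ (EuclideanSpace ℝ ι)) :
    MeasurePreserving (fun w : ι → ℝ => V.orthogonalProjectionOnto (WithLp.toLp 2 w))
      (Measure.pi fun _ => gaussianReal 0 1) (stdGaussian V) where
  measurable := by fun_prop
  map_eq := by
    rw [← stdGaussian_map_orthogonalProjectionOnto, ← map_pi_eq_stdGaussian,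
      Measure.map_map (by fun_prop) (by fun_prop)]
    rfl

/-- Upper tail of a chi-squared variable, by the Chernoff bound at parameter `1 / 4`. -/
lemma norm_sq_starProjection_ge_le (V : Submodule ℝ (EuclideanSpace ℝ ι)) (t : ℝ) :
    (Measure.pi fun _ : ι => gaussianReal 0 1).real
      {w | t ≤ ‖V.starProjection (WithLp.toLp 2 w)‖ ^ 2}
      ≤ Real.exp (-t / 4) * 2 ^ Module.finrank ℝ V := by
  have h := (measurePreserving_orthogonalProjectionOnto_toLp V).measureReal_preimage
    (s := {v : V | t ≤ ‖v‖ ^ 2})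
    (measurableSet_le (by fun_prop) (by fun_prop)).nullMeasurableSet
  refine (h.le.trans (measure_ge_le_exp_mul_mgf (t := 1 / 4) t (by norm_num)
    (integrable_exp_mul_norm_sq_stdGaussian (by norm_num)))).trans ?_
  rw [mgf_norm_sq_stdGaussian (by norm_num)]
  have : (√(1 - 2 * (1 / 4)))⁻¹ ≤ 2 := by
    rw [inv_le_comm₀ (by norm_num) (by norm_num)]
    exact Real.le_sqrt_of_sq_le (by norm_num)
  have e : -(1 / 4) * t = -t / 4 := by ring
  rw [e]
  gcongr

/-- Lower tail of a chi-squared variable, by the Chernoff bound at parameter `-4`. -/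
lemma norm_sq_starProjection_le_le (V : Submodule ℝ (EuclideanSpace ℝ ι)) (t : ℝ) :
    (Measure.pi fun _ : ι => gaussianReal 0 1).real
      {w | ‖V.starProjection (WithLp.toLp 2 w)‖ ^ 2 ≤ t}
      ≤ Real.exp (4 * t) * (1 / 3) ^ Module.finrank ℝ V := by
  have h := (measurePreserving_orthogonalProjectionOnto_toLp V).measureReal_preimage
    (s := {v : V | ‖v‖ ^ 2 ≤ t})
    (measurableSet_le (by fun_prop) (by fun_prop)).nullMeasurableSet
  refine (h.le.trans (measure_le_le_exp_mul_mgf (t := -4) t (by norm_num)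
    (integrable_exp_mul_norm_sq_stdGaussian (by norm_num)))).trans ?_
  rw [mgf_norm_sq_stdGaussian (by norm_num)]
  have : √(1 - 2 * (-4)) = 3 := by
    rw [show (1 - 2 * (-4) : ℝ) = 3 ^ 2 by norm_num]
    exact Real.sqrt_sq (by norm_num)
  rw [this]
  norm_num

/-- A linear combination of independent standard Gaussians with a unit coefficient vector is a
standard Gaussian. -/
lemma map_pi_gaussianReal_sum_mul (a : ι → ℝ) (ha : ∑ j, a j ^ 2 = 1) :
    (Measure.pi fun _ : ι => gaussianReal 0 1).map (fun x => ∑ j, x j * a j)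
      = gaussianReal 0 1 := by
  apply Measure.ext_of_charFun
  ext t
  have := charFun_stdGaussian (WithLp.toLp 2 (fun j => t * a j) : EuclideanSpace ℝ ι)
  rw [← map_pi_eq_stdGaussian, charFun_apply, integral_map (by fun_prop) (by fun_prop)] at this
  rw [charFun_apply, integral_map (Measurable.aemeasurable (by fun_prop)) (by fun_prop)]
  have hn : ‖(WithLp.toLp 2 (fun j => t * a j) : EuclideanSpace ℝ ι)‖ ^ 2 = t ^ 2 := by
    simp [EuclideanSpace.norm_sq_eq, mul_pow, ← Finset.mul_sum, ha]
  rw [charFun_gaussianReal]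
  rw [← Complex.ofReal_pow, hn] at this
  simp only [PiLp.inner_apply, RCLike.inner_apply, conj_trivial] at this
  convert this using 1
  · congr 1; ext x
    simp only [RCLike.inner_apply, conj_trivial, Finset.mul_sum]
    congr 4
    ext j; ring
  · simp [neg_div]

end

/-! ### Splitting a Gaussian matrix by columns -/

/-- The restriction of a Gaussian row to `U` is independent of a normalized combination of the
other entries. -/
lemma measurePreserving_restrict_prod_sum_mul {p : ℕ} (U : Finset (Fin p)) (a : Fin p → ℝ)
    (ha : ∑ j : {j // j ∉ U}, a j ^ 2 = 1) :
    MeasurePreserving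
      (fun x : Fin p → ℝ => ((fun j : U => x j), ∑ j : {j // j ∉ U}, x j * a j))
      (Measure.pi fun _ => gaussianReal 0 1)
      ((Measure.pi fun _ : U => gaussianReal 0 1).prod (gaussianReal 0 1)) := by
  have h1 := measurePreserving_piEquivPiSubtypeProd
    (fun _ : Fin p => gaussianReal 0 1) (fun j => j ∈ U)
  have h2 : MeasurePreserving (fun x : {j // j ∉ U} → ℝ => ∑ j, x j * a j)
      (Measure.pi fun _ => gaussianReal 0 1) (gaussianReal 0 1) :=
    ⟨by fun_prop, map_pi_gaussianReal_sum_mul (fun j : {j // j ∉ U} => a j) ha⟩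
  convert ((MeasurePreserving.id _).prod h2).comp h1 using 2
  · rfl
  · congr!

/-- The columns indexed by `U` are independent of a normalized combination of the other columns,
which is a standard Gaussian vector. -/
lemma measurePreserving_submatrix_prod_sum_mul {n p : ℕ} (U : Finset (Fin p)) (a : Fin p → ℝ)
    (ha : ∑ j : {j // j ∉ U}, a j ^ 2 = 1) :
    MeasurePreserving
      (fun X : Fin n → Fin p → ℝ =>
        ((fun i (j : U) => X i j), fun i => ∑ j : {j // j ∉ U}, X i j * a j))
      (Measure.pi fun _ => Measure.pi fun _ => gaussianReal 0 1)
      ((Measure.pi fun _ => Measure.pi fun _ => gaussianReal 0 1).prod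
        (Measure.pi fun _ => gaussianReal 0 1)) :=
  (measurePreserving_arrowProdEquivProdArrow (U → ℝ) ℝ (Fin n) _ _).comp
    (measurePreserving_pi _ _ fun _ => measurePreserving_restrict_prod_sum_mul U a ha)

/-! ### Comparing the fits of two subspaces -/

section
variable {E : Type*} [NormedAddCommGroup E] [InnerProductSpace ℝ E] [FiniteDimensional ℝ E]

/-- Raising the subspace from `V` to `V'` lowers the squared distance by the squared length of
the projection onto the orthogonal complement of `V` in `V'`. -/
lemma norm_sq_sub_starProjection_sub {V V' : Submodule ℝ E} (h : V ≤ V') (y : E) :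
    ‖y - V.starProjection y‖ ^ 2 - ‖y - V'.starProjection y‖ ^ 2
      = ‖(Vᗮ ⊓ V').starProjection y‖ ^ 2 := by
  have hQ : (Vᗮ ⊓ V').starProjection y = V'.starProjection y - V.starProjection y := by
    apply Submodule.eq_starProjection_of_mem_of_inner_eq_zero
    · refine ⟨?_, V'.sub_mem (by simp) (h (by simp))⟩
      have : V'.starProjection y - V.starProjection y
          = (y - V.starProjection y) - (y - V'.starProjection y) := by abel
      rw [this]
      exact Vᗮ.sub_mem (V.sub_starProjection_mem_orthogonal y)
        (Submodule.orthogonal_le h (V'.sub_starProjection_mem_orthogonal y))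
    · rintro w ⟨hw, hw'⟩
      have h1 : inner ℝ (y - V'.starProjection y) w = 0 := V'.starProjection_inner_eq_zero y w hw'
      have h2 : inner ℝ (V.starProjection y) w = 0 := hw _ (by simp)
      rw [show y - (V'.starProjection y - V.starProjection y)
        = (y - V'.starProjection y) + V.starProjection y by abel, inner_add_left, h1, h2, add_zero]
  have h1 : inner ℝ (y - V'.starProjection y) (V'.starProjection y - V.starProjection y) = 0 :=
    V'.starProjection_inner_eq_zero y _ (V'.sub_mem (by simp) (h (by simp)))
  have h2 := norm_add_sq_real (y - V'.starProjection y) (V'.starProjection y - V.starProjection y)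
  rw [sub_add_sub_cancel, h1] at h2
  rw [hQ, h2]; ring

/-- If `V` fits `z + w` at least as well as a subspace `V₀` that contains the signal `z`, then
either `z` lies close to `V`, or the noise `w` has a large component in one of the two directions
in which `V` and `V₀` fall short of a common superspace `V'`. -/
lemma norm_sq_sub_starProjection_le_of_fit {V V₀ V' : Submodule ℝ E} (hV : V ≤ V') (hV₀ : V₀ ≤ V')
    {z w : E} (hz : z ∈ V₀) {t : ℝ}
    (hfit : ‖z + w - V.starProjection (z + w)‖ ^ 2 ≤ ‖z + w - V₀.starProjection (z + w)‖ ^ 2)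
    (h1 : ‖(Vᗮ ⊓ V').starProjection w‖ ^ 2 < t)
    (h2 : ‖(V₀ᗮ ⊓ V').starProjection w‖ ^ 2 < t) :
    ‖z - V.starProjection z‖ ^ 2 ≤ 4 * t := by
  have a1 := norm_sq_sub_starProjection_sub hV (z + w)
  have a2 := norm_sq_sub_starProjection_sub hV₀ (z + w)
  have a3 := norm_sq_sub_starProjection_sub hV z
  have hz' : V'.starProjection z = z := Submodule.starProjection_eq_self_iff.2 (hV₀ hz)
  have hz0 : (V₀ᗮ ⊓ V').starProjection z = 0 := by
    rw [Submodule.starProjection_apply_eq_zero_iff]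
    exact Submodule.orthogonal_le inf_le_left (Submodule.le_orthogonal_orthogonal _ hz)
  rw [map_add (V₀ᗮ ⊓ V').starProjection, hz0, zero_add] at a2
  rw [map_add (Vᗮ ⊓ V').starProjection] at a1
  rw [hz', sub_self, norm_zero] at a3
  set A := (Vᗮ ⊓ V').starProjection z
  set B := (Vᗮ ⊓ V').starProjection w
  -- `V'` and `V₀` contain the signal, so `a1`, `a2` and `hfit` compare `A + B` with noise only
  have a4 : ‖A + B‖ ^ 2 < t := by linarith
  have ht : 0 < t := lt_of_le_of_lt (by positivity) h1
  have b1 : ‖B‖ < √t := Real.lt_sqrt_of_sq_lt h1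
  have b2 : ‖A + B‖ < √t := Real.lt_sqrt_of_sq_lt a4
  have b3 : ‖A‖ ≤ ‖A + B‖ + ‖B‖ := by simpa using norm_sub_le (A + B) B
  have b4 : ‖A‖ ≤ 2 * √t := by linarith
  have b5 : ‖A‖ ^ 2 ≤ (2 * √t) ^ 2 := by gcongr
  rw [mul_pow, Real.sq_sqrt ht.le] at b5
  linarith

end

/-! ### The least-squares error as a distance to a column space -/

variable {n p : ℕ} {ι : Type*} [Fintype ι]

/-- The span of the columns of `A` in Euclidean space. -/
def colSpan (A : Fin n → ι → ℝ) : Submodule ℝ (EuclideanSpace ℝ (Fin n)) :=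
  Submodule.span ℝ (Set.range fun j => WithLp.toLp 2 fun i => A i j)

/-- The least-squares error of fitting `Y` by the columns of `A`; `lsError X Y U` is the case where
`A` consists of the columns of `X` indexed by `U`. -/
noncomputable def residual (A : Fin n → ι → ℝ) (Y : Fin n → ℝ) : ℝ :=
  ⨅ θ : ι → ℝ, ∑ i, (Y i - ∑ j, A i j * θ j) ^ 2

lemma mem_colSpan_iff {A : Fin n → ι → ℝ} {v : EuclideanSpace ℝ (Fin n)} :
    v ∈ colSpan A ↔ ∃ θ : ι → ℝ, v = WithLp.toLp 2 fun i => ∑ j, A i j * θ j := by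
  rw [colSpan, Submodule.mem_span_range_iff_exists_fun]
  refine exists_congr fun θ => ?_
  rw [eq_comm]
  suffices ∑ j, θ j • (WithLp.toLp 2 fun i => A i j : EuclideanSpace ℝ (Fin n))
      = WithLp.toLp 2 fun i => ∑ j, A i j * θ j by rw [this]
  ext i
  simp [mul_comm]

lemma finrank_colSpan_le (A : Fin n → ι → ℝ) :
    Module.finrank ℝ (colSpan A) ≤ Fintype.card ι :=
  finrank_range_le_card _

lemma residual_eq (A : Fin n → ι → ℝ) (Y : Fin n → ℝ) :
    residual A Y
      = ‖WithLp.toLp 2 Y - (colSpan A).starProjection (WithLp.toLp 2 Y)‖ ^ 2 := by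
  have key : ∀ θ : ι → ℝ, ∑ i, (Y i - ∑ j, A i j * θ j) ^ 2
      = ‖(WithLp.toLp 2 Y : EuclideanSpace ℝ (Fin n))
        - WithLp.toLp 2 fun i => ∑ j, A i j * θ j‖ ^ 2 := by
    intro θ; simp [EuclideanSpace.norm_sq_eq]
  unfold residual
  simp_rw [key]
  apply le_antisymm
  · obtain ⟨θ, hθ⟩ := mem_colSpan_iff.1
      (Submodule.starProjection_apply_mem (colSpan A) (WithLp.toLp 2 Y))
    rw [hθ]
    exact ciInf_le ⟨0, by rintro _ ⟨θ, rfl⟩; positivity⟩ θ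
  · refine le_ciInf fun θ => ?_
    gcongr
    rw [Submodule.starProjection_minimal]
    exact ciInf_le ⟨0, by rintro _ ⟨θ, rfl⟩; positivity⟩
      (⟨_, mem_colSpan_iff.2 ⟨θ, rfl⟩⟩ : colSpan A)

lemma residual_const_mul (A : Fin n → ι → ℝ) (Y : Fin n → ℝ) (c : ℝ) :
    residual A (fun i => c * Y i) = c ^ 2 * residual A Y := by
  have : (WithLp.toLp 2 fun i => c * Y i : EuclideanSpace ℝ (Fin n)) = c • WithLp.toLp 2 Y := rfl
  rw [residual_eq, residual_eq, this, map_smul, ← smul_sub, norm_smul, mul_pow, Real.norm_eq_abs,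
    sq_abs]

lemma residual_add_of_mem (A : Fin n → ι → ℝ) (Y Z : Fin n → ℝ)
    (hZ : WithLp.toLp 2 Z ∈ colSpan A) :
    residual A (fun i => Z i + Y i) = residual A Y := by
  have : (WithLp.toLp 2 fun i => Z i + Y i : EuclideanSpace ℝ (Fin n))
    = WithLp.toLp 2 Z + WithLp.toLp 2 Y := rfl
  rw [residual_eq, residual_eq, this, map_add, Submodule.starProjection_eq_self_iff.2 hZ,
    add_sub_add_left_eq_sub]

/-- The least-squares error is measurable because it is upper semicontinuous, as an infimum of
continuous functions. -/
lemma measurable_residual :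
    Measurable fun q : (Fin n → ι → ℝ) × (Fin n → ℝ) => residual q.1 q.2 := by
  refine UpperSemicontinuous.measurable (upperSemicontinuous_ciInf
    (fun x => ⟨0, by rintro _ ⟨θ, rfl⟩; positivity⟩) fun θ => Continuous.upperSemicontinuous ?_)
  fun_prop

/-- The columns of `X` indexed by `U`. -/
def cols (X : Fin n → Fin p → ℝ) (U : Finset (Fin p)) : Fin n → U → ℝ := fun i j => X i j

lemma lsError_eq_residual (X : Fin n → Fin p → ℝ) (Y : Fin n → ℝ) (U : Finset (Fin p)) :
    lsError X Y U = residual (cols X U) Y := rfl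

lemma measurable_lsError (U : Finset (Fin p)) :
    Measurable fun q : (Fin n → Fin p → ℝ) × (Fin n → ℝ) => lsError q.1 q.2 U := by
  refine measurable_residual.comp (f := fun q : (Fin n → Fin p → ℝ) × (Fin n → ℝ) =>
    (cols q.1 U, q.2)) ?_
  unfold cols
  fun_prop

lemma colSpan_cols (X : Fin n → Fin p → ℝ) (U : Finset (Fin p)) :
    colSpan (cols X U) = Submodule.span ℝ
      ((fun j => (WithLp.toLp 2 fun i => X i j : EuclideanSpace ℝ (Fin n))) ''
        (U : Set (Fin p))) := by
  rw [colSpan, Set.image_eq_range]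
  rfl

lemma colSpan_cols_mono (X : Fin n → Fin p → ℝ) {U T : Finset (Fin p)} (h : U ⊆ T) :
    colSpan (cols X U) ≤ colSpan (cols X T) := by
  rw [colSpan_cols, colSpan_cols]
  exact Submodule.span_mono (Set.image_mono (by exact_mod_cast h))

lemma sum_mul_mem_colSpan_cols (X : Fin n → Fin p → ℝ) (U : Finset (Fin p)) (b : Fin p → ℝ) :
    (WithLp.toLp 2 fun i => ∑ j ∈ U, X i j * b j) ∈ colSpan (cols X U) :=
  mem_colSpan_iff.2 ⟨fun j => b j, by
    ext i
    exact (Finset.sum_coe_sort U fun j => X i j * b j).symm⟩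

lemma finrank_orthogonal_inf_colSpan_le (X : Fin n → Fin p → ℝ) {U T : Finset (Fin p)}
    (h : U ⊆ T) :
    Module.finrank ℝ ((colSpan (cols X U))ᗮ ⊓ colSpan (cols X T) : Submodule ℝ _)
      ≤ (T \ U).card := by
  have h1 := Submodule.finrank_add_inf_finrank_orthogonal (colSpan_cols_mono X h)
  have h2 : colSpan (cols X T) = colSpan (cols X U) ⊔ colSpan (cols X (T \ U)) := by
    rw [colSpan_cols, colSpan_cols, colSpan_cols, ← Submodule.span_union, ← Set.image_union,
      ← Finset.coe_union, Finset.union_sdiff_of_subset h]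
  have h3 := Submodule.finrank_add_le_finrank_add_finrank (colSpan (cols X U))
    (colSpan (cols X (T \ U)))
  have h4 := finrank_colSpan_le (cols X (T \ U))
  rw [← h2] at h3
  rw [Fintype.card_coe] at h4
  omega

/-! ### Error probability for one competing support -/

/-- A product measure of `D` is bounded by a bound on the measures of almost all sections. -/
lemma measureReal_prod_le {A B : Type*} [MeasurableSpace A] [MeasurableSpace B] (μ : Measure A)
    (ν : Measure B) [IsProbabilityMeasure μ] [IsProbabilityMeasure ν] {D : Set (A × B)}
    (hD : MeasurableSet D) {c : ℝ} (hc : 0 ≤ c)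
    (h : ∀ᵐ x ∂μ, ν.real {y | (x, y) ∈ D} ≤ c) : (μ.prod ν).real D ≤ c := by
  refine ENNReal.toReal_le_of_le_ofReal hc ?_
  rw [Measure.prod_apply hD]
  calc ∫⁻ x, ν (Prod.mk x ⁻¹' D) ∂μ ≤ ∫⁻ _, ENNReal.ofReal c ∂μ := by
        refine lintegral_mono_ae (h.mono fun x hx => ?_)
        rw [← ofReal_measureReal]
        exact ENNReal.ofReal_le_ofReal hx
    _ = ENNReal.ofReal c := by simp

instance : IsProbabilityMeasure (ensemble n p) := by unfold ensemble; infer_instance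

/-- The drop of the residual of the noise when the support grows from `U` to `T` is a chi-squared
variable with at most `(T \ U).card` degrees of freedom, conditionally on `X`. -/
lemma ensemble_excess_residual_le {U T : Finset (Fin p)} (h : U ⊆ T) (t : ℝ) :
    (ensemble n p).real {q | t ≤ lsError q.1 q.2 U - lsError q.1 q.2 T}
      ≤ Real.exp (-t / 4) * 2 ^ (T \ U).card := by
  have hD : MeasurableSet {q : (Fin n → Fin p → ℝ) × (Fin n → ℝ) |
      t ≤ lsError q.1 q.2 U - lsError q.1 q.2 T} :=
    measurableSet_le measurable_const ((measurable_lsError U).sub (measurable_lsError T))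
  refine measureReal_prod_le _ _ hD (by positivity) (ae_of_all _ fun X => ?_)
  have e : {W | (X, W) ∈ {q : (Fin n → Fin p → ℝ) × (Fin n → ℝ) |
        t ≤ lsError q.1 q.2 U - lsError q.1 q.2 T}}
      = {W | t ≤ ‖((colSpan (cols X U))ᗮ ⊓ colSpan (cols X T)).starProjection
          (WithLp.toLp 2 W)‖ ^ 2} := by
    ext W
    change t ≤ lsError X W U - lsError X W T ↔ _
    rw [lsError_eq_residual, lsError_eq_residual, residual_eq, residual_eq,
      norm_sq_sub_starProjection_sub (colSpan_cols_mono X h)]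
    rfl
  rw [e]
  refine (norm_sq_starProjection_ge_le _ t).trans ?_
  gcongr
  · norm_num
  · exact finrank_orthogonal_inf_colSpan_le X h

lemma residual_le_le {ι : Type*} [Fintype ι] (A : Fin n → ι → ℝ) (t : ℝ) :
    (Measure.pi fun _ : Fin n => gaussianReal 0 1).real {g | residual A g ≤ t}
      ≤ Real.exp (4 * t) * (1 / 3) ^ (n - Fintype.card ι) := by
  simp only [residual_eq, ← Submodule.starProjection_orthogonal_val]
  refine (norm_sq_starProjection_le_le _ t).trans ?_
  gcongr ?_ * ?_
  apply pow_le_pow_of_le_one (by norm_num) (by norm_num)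
  have h1 := (colSpan A).finrank_add_finrank_orthogonal
  have h2 := finrank_colSpan_le A
  rw [finrank_euclideanSpace_fin] at h1
  omega

/-- The part of the signal carried by the columns outside `U` is a Gaussian vector independent of
the columns in `U`, so its distance to their span has a chi-squared lower tail. -/
lemma signal_residual_le_le (U : Finset (Fin p)) (β : Fin p → ℝ)
    (hb : 0 < ∑ j : {j // j ∉ U}, β j ^ 2) (t : ℝ) :
    (Measure.pi fun _ : Fin n => Measure.pi fun _ : Fin p => gaussianReal 0 1).real
      {X | lsError X (fun i => ∑ j, X i j * β j) U ≤ (∑ j : {j // j ∉ U}, β j ^ 2) * t}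
      ≤ Real.exp (4 * t) * (1 / 3) ^ (n - U.card) := by
  set b2 := ∑ j : {j // j ∉ U}, β j ^ 2
  set b := √b2 with hbdef
  have hb0 : 0 < b := Real.sqrt_pos.2 hb
  have hbsq : b ^ 2 = b2 := Real.sq_sqrt hb.le
  have ha : ∑ j : {j // j ∉ U}, (fun j => β j / b) (j : Fin p) ^ 2 = 1 := by
    simp only [div_pow, ← Finset.sum_div, hbsq]
    exact div_self hb.ne'
  have hmp := measurePreserving_submatrix_prod_sum_mul (n := n) U (fun j => β j / b) ha
  have hD : MeasurableSet {q : (Fin n → U → ℝ) × (Fin n → ℝ) | residual q.1 q.2 ≤ t} :=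
    measurableSet_le measurable_residual measurable_const
  have hpre := hmp.measureReal_preimage hD.nullMeasurableSet
  have hset : {X : Fin n → Fin p → ℝ | lsError X (fun i => ∑ j, X i j * β j) U ≤ b2 * t}
      = (fun X : Fin n → Fin p → ℝ => ((fun i (j : U) => X i j),
        fun i => ∑ j : {j // j ∉ U}, X i j * (β j / b))) ⁻¹'
        {q : (Fin n → U → ℝ) × (Fin n → ℝ) | residual q.1 q.2 ≤ t} := by
    ext X
    have e1 : (fun i => ∑ j, X i j * β j) = fun i => (∑ j ∈ U, X i j * β j)
        + b * ∑ j : {j // j ∉ U}, X i j * (β j / b) := by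
      ext i
      rw [Finset.mul_sum]
      have : ∀ j : {j // j ∉ U}, b * (X i j * (β j / b)) = X i j * β j := by
        intro j; field_simp
      simp_rw [this]
      rw [← Finset.sum_add_sum_compl U]
      congr 1
      exact (Finset.sum_subtype Uᶜ (fun j => Finset.mem_compl) (fun j => X i j * β j))
    simp only [Set.mem_ofPred_eq, Set.mem_preimage]
    rw [e1, lsError_eq_residual, residual_add_of_mem _ _ _ (sum_mul_mem_colSpan_cols X U β),
      residual_const_mul, hbsq, mul_le_mul_iff_right₀ hb]
    rfl
  rw [hset, hpre]
  refine measureReal_prod_le _ _ hD (by positivity) (ae_of_all _ fun A => ?_)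
  simpa using residual_le_le A t

/-- The event that `U` fits the observations at least as well as the true support. -/
def fitEvent (n : ℕ) (β : Fin p → ℝ) (U : Finset (Fin p)) :
    Set ((Fin n → Fin p → ℝ) × (Fin n → ℝ)) :=
  {q | lsError q.1 (observe q.1 β q.2) U ≤ lsError q.1 (observe q.1 β q.2) (supp β)}

/-- If `U` wins, then the signal is nearly fitted by `U`, or the noise has a large component in one
of two spaces of small dimension. -/
lemma fitEvent_subset (β : Fin p → ℝ) (U : Finset (Fin p)) (t : ℝ) :
    fitEvent n β U ⊆ {X | lsError X (fun i => ∑ j, X i j * β j) U ≤ 4 * t} ×ˢ Set.univ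
      ∪ ({q | t ≤ lsError q.1 q.2 U - lsError q.1 q.2 (supp β ∪ U)}
        ∪ {q | t ≤ lsError q.1 q.2 (supp β) - lsError q.1 q.2 (supp β ∪ U)}) := by
  rintro ⟨X, W⟩ hq
  by_contra hcon
  simp only [Set.mem_union, Set.mem_prod, Set.mem_ofPred_eq, Set.mem_univ, and_true, not_or,
    not_le] at hcon
  obtain ⟨h0, h1, h2⟩ := hcon
  refine h0.not_ge ?_
  have hV := colSpan_cols_mono X (Finset.subset_union_right (s₁ := supp β) (s₂ := U))
  have hV₀ := colSpan_cols_mono X (Finset.subset_union_left (s₁ := supp β) (s₂ := U))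
  have hz : (WithLp.toLp 2 fun i => ∑ j, X i j * β j) ∈ colSpan (cols X (supp β)) := by
    convert sum_mul_mem_colSpan_cols X (supp β) β using 3 with i
    refine (Finset.sum_subset (Finset.subset_univ _) fun j _ hj => ?_).symm
    simp only [supp, Finset.mem_filter, Finset.mem_univ, true_and, not_not] at hj
    simp [hj]
  simp only [lsError_eq_residual, residual_eq] at h1 h2 ⊢
  rw [norm_sq_sub_starProjection_sub hV] at h1
  rw [norm_sq_sub_starProjection_sub hV₀] at h2
  refine norm_sq_sub_starProjection_le_of_fit hV hV₀ hz ?_ h1 h2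
  simp only [fitEvent, Set.mem_ofPred_eq, lsError_eq_residual, residual_eq] at hq
  exact hq

lemma exp_mul_third_pow_le {s : ℕ} (h : 2 * s ≤ n) :
    Real.exp (n / 4) * (1 / 3) ^ (n - s) ≤ Real.exp (-(n / 4 : ℝ)) := by
  have h3 : (1 / 3 : ℝ) ≤ Real.exp (-1) := by
    rw [Real.exp_neg, one_div]
    gcongr
    linarith [Real.exp_one_lt_d9]
  have hs : (2 * s : ℝ) ≤ n := by exact_mod_cast h
  calc Real.exp (n / 4) * (1 / 3) ^ (n - s) ≤ Real.exp (n / 4) * Real.exp (-1) ^ (n - s) := by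
        gcongr
    _ = Real.exp (n / 4 + ((n - s : ℕ) : ℝ) * (-1)) := by rw [← Real.exp_nat_mul, ← Real.exp_add]
    _ ≤ _ := by
        rw [Nat.cast_sub (by omega)]
        gcongr
        linarith

/-- The pairwise error probability decays exponentially in `n`, up to a term that decays
exponentially in `n M²` times the number of missed indices. -/
lemma measureReal_fitEvent_le {s : ℕ} {M : ℝ} (hM : 0 < M) {β : Fin p → ℝ}
    (hβ : ∀ j ∈ supp β, M ≤ |β j|) (hn : 2 * s ≤ n) (hs : (supp β).card = s)
    {U : Finset (Fin p)} (hU : U.card = s) (hne : U ≠ supp β) :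
    (ensemble n p).real (fitEvent n β U) ≤ Real.exp (-(n / 4 : ℝ))
      + 2 * (2 * Real.exp (-(n * M ^ 2 / 256))) ^ (supp β \ U).card := by
  set S := supp β
  set k := (S \ U).card with hk
  have hkU : (U \ S).card = k := Finset.card_sdiff_comm (hU.trans hs.symm)
  have hkpos : 0 < k := by
    rw [hk, Finset.card_pos, Finset.sdiff_nonempty]
    intro hsub
    exact hne (Finset.eq_of_subset_of_card_le hsub (by omega)).symm
  set b2 := ∑ j : {j // j ∉ U}, β j ^ 2 with hb2
  have hb2k : k * M ^ 2 ≤ b2 := by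
    have e : b2 = ∑ j ∈ Uᶜ, β j ^ 2 :=
      (Finset.sum_subtype Uᶜ (fun j => Finset.mem_compl) (fun j => β j ^ 2)).symm
    rw [e, hk, ← nsmul_eq_mul, ← Finset.sum_const]
    calc ∑ _ ∈ S \ U, M ^ 2 ≤ ∑ j ∈ S \ U, β j ^ 2 := by
          refine Finset.sum_le_sum fun j hj => ?_
          rw [← sq_abs (β j)]
          gcongr
          exact hβ j (Finset.mem_sdiff.1 hj).1
      _ ≤ _ := Finset.sum_le_sum_of_subset_of_nonneg
          (fun j hj => by simpa using (Finset.mem_sdiff.1 hj).2) fun _ _ _ => by positivity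
  have hb2pos : 0 < b2 := lt_of_lt_of_le (by positivity) hb2k
  -- the threshold `4 * t` is a sixteenth of `n * b2`, of the order of the typical squared distance
  -- of the signal to the columns in `U`
  set t : ℝ := b2 * (n / 64) with ht
  have hnoise : Real.exp (-t / 4) * 2 ^ k ≤ (2 * Real.exp (-(n * M ^ 2 / 256))) ^ k := by
    rw [mul_pow, mul_comm, ← Real.exp_nat_mul]
    gcongr
    rw [ht]
    have : (k * M ^ 2) * (n / 64) ≤ b2 * (n / 64) := by gcongr
    linarith
  refine (measureReal_mono (fitEvent_subset β U t)).trans ?_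
  refine (measureReal_union_le _ _).trans (add_le_add ?_ ?_)
  · rw [ensemble, measureReal_prod_prod, probReal_univ, mul_one]
    have h4 : 4 * t = b2 * (n / 16) := by rw [ht]; ring
    rw [h4]
    refine (signal_residual_le_le U β hb2pos (n / 16)).trans ?_
    rw [hU, show 4 * ((n : ℝ) / 16) = n / 4 by ring]
    exact exp_mul_third_pow_le hn
  · refine (measureReal_union_le _ _).trans ?_
    rw [two_mul (_ ^ k)]
    refine add_le_add ((ensemble_excess_residual_le Finset.subset_union_right t).trans ?_)
      ((ensemble_excess_residual_le Finset.subset_union_left t).trans ?_)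
    · rwa [Finset.union_sdiff_right]
    · rwa [Finset.union_sdiff_left, hkU]

/-! ### Union bound over the competing supports -/

/-- The event that some wrong set of size `s` fits the observations at least as well as `S`.
The vector is a coordinate of the sample point, so that the event can be used both for a fixed and
for a random vector; unlike the error event of a decoder it is measurable. -/
def failureEvent (n s : ℕ) (S : Finset (Fin p)) :
    Set ((Fin p → ℝ) × (Fin n → Fin p → ℝ) × (Fin n → ℝ)) :=
  {q | ∃ U : Finset (Fin p), U.card = s ∧ U ≠ S ∧
    lsError q.2.1 (observe q.2.1 q.1 q.2.2) U ≤ lsError q.2.1 (observe q.2.1 q.1 q.2.2) S}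

lemma measurableSet_failureEvent (s : ℕ) (S : Finset (Fin p)) :
    MeasurableSet (failureEvent n s S) := by
  have hm : ∀ U : Finset (Fin p),
      Measurable fun q : (Fin p → ℝ) × (Fin n → Fin p → ℝ) × (Fin n → ℝ) =>
        lsError q.2.1 (observe q.2.1 q.1 q.2.2) U := fun U =>
    (measurable_lsError U).comp (f := fun q : (Fin p → ℝ) × (Fin n → Fin p → ℝ) × (Fin n → ℝ) =>
      (q.2.1, observe q.2.1 q.1 q.2.2)) (by unfold observe; fun_prop)
  have : failureEvent n s S = ⋃ (U : Finset (Fin p)) (_ : U.card = s ∧ U ≠ S),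
      {q | lsError q.2.1 (observe q.2.1 q.1 q.2.2) U
        ≤ lsError q.2.1 (observe q.2.1 q.1 q.2.2) S} := by
    ext q; simp [failureEvent, and_assoc]
  rw [this]
  exact .iUnion fun U => .iUnion fun _ => measurableSet_le (hm U) (hm S)

lemma mem_failureEvent_of_ne {s : ℕ} {φ : Decoder n p} (hφ : IsOptimalDecoder s φ)
    {S : Finset (Fin p)} (hS : S.card = s) {b : Fin p → ℝ} {X : Fin n → Fin p → ℝ}
    {W : Fin n → ℝ} (h : φ X (observe X b W) ≠ S) : (b, X, W) ∈ failureEvent n s S :=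
  ⟨_, (hφ X _).1, h, (hφ X _).2 S hS⟩

/-- Summing a geometric weight in the size of `S \ U` over the sets `U` as large as `S`: since
`S ∆ U` is twice as large as `S \ U` and determines `U`, the sum is bounded by a binomial one. -/
lemma sum_pow_card_sdiff_le {κ : Type*} [Fintype κ] [DecidableEq κ] (S : Finset κ) {r : ℝ}
    (hr : 0 ≤ r) :
    ∑ U ∈ (Finset.powersetCard S.card Finset.univ).erase S, (r ^ 2) ^ (S \ U).card
      ≤ (1 + r) ^ Fintype.card κ - 1 := by
  have htot : ∑ D : Finset κ, r ^ D.card = (1 + r) ^ Fintype.card κ := by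
    have := Fintype.sum_pow_mul_eq_add_pow κ r (1 : ℝ)
    simpa [add_comm] using this
  have hsplit := Finset.add_sum_erase Finset.univ (fun D : Finset κ => r ^ D.card)
    (Finset.mem_univ ∅)
  rw [htot, Finset.card_empty, pow_zero] at hsplit
  rw [← hsplit, add_sub_cancel_left]
  calc ∑ U ∈ (Finset.powersetCard S.card Finset.univ).erase S, (r ^ 2) ^ (S \ U).card
      = ∑ U ∈ (Finset.powersetCard S.card Finset.univ).erase S, r ^ (symmDiff S U).card := by
        refine Finset.sum_congr rfl fun U hU => ?_
        have hc : U.card = S.card := (Finset.mem_powersetCard.1 (Finset.mem_of_mem_erase hU)).2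
        rw [← pow_mul, symmDiff_def, Finset.sup_eq_union,
          Finset.card_union_of_disjoint disjoint_sdiff_sdiff,
          Finset.card_sdiff_comm hc, two_mul]
    _ = ∑ D ∈ ((Finset.powersetCard S.card Finset.univ).erase S).image (symmDiff S),
          r ^ D.card := by
        rw [Finset.sum_image]
        exact (symmDiff_right_injective S).injOn
    _ ≤ _ := by
        refine Finset.sum_le_sum_of_subset_of_nonneg ?_ fun _ _ _ => by positivity
        intro D hD
        obtain ⟨U, hU, rfl⟩ := Finset.mem_image.1 hD
        simp only [Finset.mem_erase, Finset.mem_univ, and_true]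
        intro h0
        exact (Finset.mem_erase.1 hU).1 (symmDiff_eq_bot.1 h0).symm

/-- Union bound, for a fixed vector. -/
lemma measureReal_failureEvent_le {s : ℕ} {M : ℝ} (hM : 0 < M) {β : Fin p → ℝ}
    (hβ : ∀ j ∈ supp β, M ≤ |β j|) (hn : 2 * s ≤ n) (hs : (supp β).card = s) :
    (ensemble n p).real {q | (β, q) ∈ failureEvent n s (supp β)}
      ≤ p.choose s * Real.exp (-(n / 4 : ℝ))
        + 2 * ((1 + √(2 * Real.exp (-(n * M ^ 2 / 256)))) ^ p - 1) := by
  have hset : {q | (β, q) ∈ failureEvent n s (supp β)}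
      = ⋃ U ∈ (Finset.powersetCard s Finset.univ).erase (supp β), fitEvent n β U := by
    ext q
    simp only [failureEvent, fitEvent, Set.mem_ofPred_eq, Set.mem_iUnion, Finset.mem_erase,
      Finset.mem_powersetCard, Finset.subset_univ, true_and, exists_prop]
    exact exists_congr fun U => by tauto
  rw [hset]
  refine (measureReal_biUnion_finset_le _ _).trans ?_
  calc _ ≤ ∑ U ∈ (Finset.powersetCard s Finset.univ).erase (supp β), (Real.exp (-(n / 4 : ℝ))
          + 2 * (√(2 * Real.exp (-(n * M ^ 2 / 256))) ^ 2) ^ (supp β \ U).card) := by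
        refine Finset.sum_le_sum fun U hU => ?_
        rw [Real.sq_sqrt (by positivity)]
        simp only [Finset.mem_erase, Finset.mem_powersetCard, Finset.subset_univ, true_and] at hU
        exact measureReal_fitEvent_le hM hβ hn hs hU.2 hU.1
    _ ≤ _ := by
        rw [Finset.sum_add_distrib, ← Finset.mul_sum, Finset.sum_const, nsmul_eq_mul]
        gcongr
        · calc _ ≤ (Finset.powersetCard s (Finset.univ : Finset (Fin p))).card :=
              Finset.card_erase_le
            _ = _ := by simp
        · subst hs
          have := sum_pow_card_sdiff_le (supp β)
            (Real.sqrt_nonneg (2 * Real.exp (-(n * M ^ 2 / 256))))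
          rwa [Fintype.card_fin] at this

lemma minAbs_le {β : Fin p → ℝ} {j : Fin p} (hj : j ∈ supp β) : minAbs β ≤ |β j| := by
  have hj' : β j ≠ 0 := by simpa [supp] using hj
  exact ciInf_le (f := fun i : {i : Fin p // β i ≠ 0} => |β i|)
    ⟨0, by rintro _ ⟨i, rfl⟩; positivity⟩ ⟨j, hj'⟩

/-- The bound on the error probability given by the union bound over wrong supports. -/
noncomputable def errorBound (n p s : ℕ) (M : ℝ) : ℝ :=
  p.choose s * Real.exp (-(n / 4 : ℝ))
    + 2 * ((1 + √(2 * Real.exp (-(n * M ^ 2 / 256)))) ^ p - 1)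

lemma errorBound_nonneg (n p s : ℕ) (M : ℝ) : 0 ≤ errorBound n p s M := by
  have : (1 : ℝ) ≤ (1 + √(2 * Real.exp (-(n * M ^ 2 / 256)))) ^ p :=
    one_le_pow₀ (by linarith [Real.sqrt_nonneg (2 * Real.exp (-(n * M ^ 2 / 256)))])
  unfold errorBound
  have : (0 : ℝ) ≤ (1 + √(2 * Real.exp (-(n * M ^ 2 / 256)))) ^ p - 1 := by linarith
  positivity

lemma errorProb_le {s : ℕ} {M : ℝ} {φ : Decoder n p} (hφ : IsOptimalDecoder s φ)
    (hM : 0 < M) (hn : 2 * s ≤ n) {β : Fin p → ℝ} (hs : (supp β).card = s) (hβ : M ≤ minAbs β) :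
    errorProb φ β ≤ errorBound n p s M :=
  (measureReal_mono (s₂ := {q | (β, q) ∈ failureEvent n s (supp β)})
    fun q hq => mem_failureEvent_of_ne hφ hs hq).trans
    (measureReal_failureEvent_le hM (fun _ hj => hβ.trans (minAbs_le hj)) hn hs)

lemma condErrorProb_le {s : ℕ} {M : ℝ} {φ : Decoder n p} (hφ : IsOptimalDecoder s φ)
    (hM : 0 < M) (hn : 2 * s ≤ n) {S : Finset (Fin p)} (hS : S.card = s)
    (ν : Measure (Fin p → ℝ)) [IsProbabilityMeasure ν]
    (hν : ∀ᵐ b ∂ν, supp b = S ∧ M ≤ minAbs b) :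
    condErrorProb φ S ν ≤ errorBound n p s M := by
  refine (measureReal_mono (s₂ := failureEvent n s S)
    fun q hq => mem_failureEvent_of_ne hφ hS hq).trans ?_
  refine measureReal_prod_le _ _ (measurableSet_failureEvent s S) (errorBound_nonneg _ _ _ _)
    (hν.mono fun b hb => ?_)
  obtain ⟨rfl, hb⟩ := hb
  exact measureReal_failureEvent_le hM (fun _ hj => hb.trans (minAbs_le hj)) hn hS

lemma avgErrorProb_le {s : ℕ} {M : ℝ} {φ : Decoder n p} (hφ : IsOptimalDecoder s φ)
    (hM : 0 < M) (hn : 2 * s ≤ n) (ν : Finset (Fin p) → Measure (Fin p → ℝ))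
    (hν : ∀ S : Finset (Fin p), S.card = s → IsProbabilityMeasure (ν S) ∧
      ∀ᵐ b ∂(ν S), supp b = S ∧ M ≤ minAbs b) :
    avgErrorProb s φ ν ≤ errorBound n p s M := by
  have h : ∑ S ∈ Finset.powersetCard s (Finset.univ : Finset (Fin p)), condErrorProb φ S (ν S)
      ≤ p.choose s * errorBound n p s M := by
    refine (Finset.sum_le_card_nsmul _ _ (errorBound n p s M) fun S hS => ?_).trans_eq (by simp)
    have hc := (Finset.mem_powersetCard.1 hS).2
    have := (hν S hc).1
    exact condErrorProb_le hφ hM hn hc _ (hν S hc).2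
  unfold avgErrorProb
  rw [one_div_mul_eq_div]
  exact div_le_of_le_mul₀ (by positivity) (errorBound_nonneg _ _ _ _) (by linarith)

/-! ### The sample-size condition -/

/-- Keep one term of the binomial expansion of `(1 + s / p) ^ p ≤ exp s`. -/
lemma choose_le_exp {p s : ℕ} (hs : 1 ≤ s) (hsp : s ≤ p) :
    (p.choose s : ℝ) ≤ Real.exp (s * (1 + Real.log (p / s))) := by
  have hs0 : (0 : ℝ) < s := by exact_mod_cast hs
  have hp0 : (0 : ℝ) < p := by exact_mod_cast hs.trans hsp
  set x : ℝ := s / p with hx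
  have hx0 : 0 < x := by positivity
  have h1 : x ^ s * p.choose s ≤ (x + 1) ^ p := by
    rw [add_pow]
    have := Finset.single_le_sum (f := fun m => x ^ m * 1 ^ (p - m) * (p.choose m : ℝ))
      (s := Finset.range (p + 1)) (fun _ _ => by positivity)
      (Finset.mem_range.2 (by omega : s < p + 1))
    simpa using this
  have h2 : (x + 1) ^ p ≤ Real.exp s := by
    calc (x + 1) ^ p ≤ Real.exp x ^ p := by gcongr; exact Real.add_one_le_exp x
      _ = Real.exp s := by
        rw [← Real.exp_nat_mul, hx]; congr 1; field_simp
  have h3 : x ^ s = Real.exp (-(s * Real.log (p / s))) := by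
    have : x = Real.exp (-Real.log (p / s)) := by
      rw [← Real.log_inv, inv_div, Real.exp_log hx0]
    rw [this, ← Real.exp_nat_mul, mul_neg]
  rw [h3] at h1
  have h4 := h1.trans h2
  rw [mul_add, mul_one, Real.exp_add]
  rw [Real.exp_neg, inv_mul_le_iff₀ (Real.exp_pos _)] at h4
  linarith

/-- The sample-size condition makes both parts of the union bound explicit null sequences. -/
lemma errorBound_le_of_sample_size {α : ℝ} (hα0 : 0 < α) (hα1 : α < 1) {n p s : ℕ} {M : ℝ}
    (hs : 1 ≤ s) (hsp : (s : ℝ) ≤ α * p) (hM : 0 < M)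
    (h : (n : ℝ) > 1024 * (1 + 1 / Real.log (1 / α)) *
      max ((s : ℝ) * Real.log ((p : ℝ) / (s : ℝ))) (1 / M ^ 2 * Real.log ((p : ℝ) - (s : ℝ)))) :
    2 * s ≤ n ∧ errorBound n p s M ≤ Real.exp (-(n / 8 : ℝ))
      + 2 * (Real.exp (2 / (1 - α) * Real.exp (-((n - s) * M ^ 2 / 1024))) - 1) := by
  set L := Real.log (1 / α) with hL
  have hL0 : 0 < L := Real.log_pos (by rw [one_div]; exact (one_lt_inv₀ hα0).2 hα1)
  have hs0 : (0 : ℝ) < s := by exact_mod_cast hs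
  have hp0 : (0 : ℝ) < p := by
    by_contra hcon
    nlinarith
  have hlog : L ≤ Real.log (p / s) := by
    apply Real.log_le_log (by positivity)
    rw [div_le_div_iff₀ hα0 hs0]
    linarith
  have hinv : 0 < 1 / L := by positivity
  set l := Real.log ((p : ℝ) / s)
  have h1 : 1024 * ((1 + 1 / L) * (s * l)) < n := by
    refine lt_of_le_of_lt ?_ h
    rw [← mul_assoc]
    gcongr
    exact le_max_left _ _
  -- `log (p / s)` is bounded below by `L`, so it absorbs the factor `exp s` of the binomial bound
  have hsl : (s : ℝ) ≤ 1 / L * (s * l) := by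
    rw [one_div_mul_eq_div, le_div_iff₀ hL0]
    gcongr
  have hsl0 : 0 < s * l := mul_pos hs0 (hL0.trans_le hlog)
  have hbin : 1024 * (s * (1 + l)) < n := by linarith
  have h2s : 2 * s ≤ n := by
    have : (2 * s : ℝ) ≤ n := by linarith
    exact_mod_cast this
  have hsp' : (s : ℝ) < p := by nlinarith
  have hps : (1 - α) * p ≤ p - s := by linarith
  have hps1 : (1 : ℝ) ≤ p - s := by
    have : s + 1 ≤ p := by exact_mod_cast hsp'
    have : (s + 1 : ℝ) ≤ p := by exact_mod_cast this
    linarith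
  have h2 : Real.log (p - s) ≤ n * M ^ 2 / 1024 := by
    have hl0 : 0 ≤ 1 / M ^ 2 * Real.log ((p : ℝ) - s) :=
      mul_nonneg (by positivity) (Real.log_nonneg hps1)
    have : 1024 * (1 / M ^ 2 * Real.log ((p : ℝ) - s)) ≤ n := by
      refine le_trans ?_ h.le
      refine mul_le_mul ?_ (le_max_right _ _) hl0 (by positivity)
      linarith
    rw [one_div_mul_eq_div, mul_div_assoc', div_le_iff₀ (by positivity)] at this
    linarith
  refine ⟨h2s, ?_⟩
  unfold errorBound
  gcongr ?_ + 2 * (?_ - 1)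
  · calc (p.choose s : ℝ) * Real.exp (-(n / 4 : ℝ))
        ≤ Real.exp (s * (1 + l)) * Real.exp (-(n / 4 : ℝ)) := by
          gcongr
          exact choose_le_exp hs (by exact_mod_cast hsp'.le)
      _ ≤ Real.exp (-(n / 8 : ℝ)) := by
          rw [← Real.exp_add]
          gcongr
          linarith
  · set r := √(2 * Real.exp (-(n * M ^ 2 / 256))) with hr
    have hr' : r ≤ 2 * Real.exp (-(n * M ^ 2 / 512)) := by
      rw [hr]
      apply Real.sqrt_le_iff.2 ⟨by positivity, ?_⟩
      rw [mul_pow, ← Real.exp_nat_mul]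
      have : ((2 : ℕ) : ℝ) * -(n * M ^ 2 / 512) = -(n * M ^ 2 / 256) := by push_cast; ring
      rw [this]
      have := Real.exp_pos (-(n * M ^ 2 / 256))
      linarith
    -- the sparsity assumption lets `log (p - s)` control `p`, even when `p - s = 1`
    have hp : (p : ℝ) ≤ 1 / (1 - α) * Real.exp (n * M ^ 2 / 1024) := by
      rw [one_div_mul_eq_div, le_div_iff₀ (by linarith), mul_comm]
      exact hps.trans ((Real.log_le_iff_le_exp (by linarith)).1 h2)
    have hr0 : 0 ≤ r := Real.sqrt_nonneg _
    have hα : 0 < 1 - α := by linarith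
    calc (1 + r) ^ p ≤ Real.exp r ^ p := by
          gcongr
          linarith [Real.add_one_le_exp r]
      _ = Real.exp (p * r) := (Real.exp_nat_mul _ _).symm
      _ ≤ _ := by
          refine Real.exp_le_exp.2 ?_
          calc p * r ≤ (1 / (1 - α) * Real.exp (n * M ^ 2 / 1024))
                * (2 * Real.exp (-(n * M ^ 2 / 512))) := by gcongr
            _ = 2 / (1 - α) * Real.exp (n * M ^ 2 / 1024 + -(n * M ^ 2 / 512)) := by
                rw [Real.exp_add]; ring
            _ ≤ _ := by
                refine mul_le_mul_of_nonneg_left (Real.exp_le_exp.2 ?_) (by positivity)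
                have : 0 < s * M ^ 2 := by positivity
                linarith

lemma tendsto_explicit_errorBound {n s : ℕ → ℕ} {M : ℕ → ℝ} (c : ℝ) (hn : Tendsto n atTop atTop)
    (hM : Tendsto (fun t => ((n t : ℝ) - (s t : ℝ)) * M t ^ 2) atTop atTop) :
    Tendsto (fun t => Real.exp (-(n t / 8 : ℝ))
      + 2 * (Real.exp (c * Real.exp (-((n t - s t) * M t ^ 2 / 1024))) - 1)) atTop (𝓝 0) := by
  have h1 : Tendsto (fun t => Real.exp (-(n t / 8 : ℝ))) atTop (𝓝 0) :=
    Real.tendsto_exp_neg_atTop_nhds_zero.comp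
      ((tendsto_natCast_atTop_atTop.comp hn).atTop_div_const (by norm_num))
  have h2 : Tendsto (fun t => Real.exp (-(((n t : ℝ) - s t) * M t ^ 2 / 1024))) atTop (𝓝 0) :=
    Real.tendsto_exp_neg_atTop_nhds_zero.comp (hM.atTop_div_const (by norm_num))
  have h3 := (Real.continuous_exp.tendsto _).comp (h2.const_mul c)
  have h4 := h1.add ((h3.sub_const 1).const_mul 2)
  simpa using h4

end SparsityRecovery

theorem theorem1 (α : ℝ) (hα0 : 0 < α) (hα1 : α < 1) :
    ∃ C : ℝ, 0 < C ∧
      ∀ (n p s : ℕ → ℕ) (M : ℕ → ℝ),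
        Tendsto n atTop atTop →
        (∀ t, 1 ≤ s t) →
        (∀ t, (s t : ℝ) ≤ α * (p t : ℝ)) →
        (∀ t, 0 < M t) →
        Tendsto (fun t => ((n t : ℝ) - (s t : ℝ)) * M t ^ 2) atTop atTop →
        (∀ᶠ t in atTop,
          (n t : ℝ) > C * max ((s t : ℝ) * Real.log ((p t : ℝ) / (s t : ℝ)))
            (1 / M t ^ 2 * Real.log ((p t : ℝ) - (s t : ℝ)))) →
        ∀ φ : ∀ t, SparsityRecovery.Decoder (n t) (p t),
          (∀ t, SparsityRecovery.IsOptimalDecoder (s t) (φ t)) →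
          -- a fixed vector at every stage
          (∀ β : ∀ t, Fin (p t) → ℝ,
            (∀ t, (SparsityRecovery.supp (β t)).card = s t) →
            (∀ t, M t ≤ SparsityRecovery.minAbs (β t)) →
            Tendsto (fun t => SparsityRecovery.errorProb (φ t) (β t)) atTop (𝓝 0)) ∧
          -- a uniformly random support, with any law of the entries on each support
          (∀ ν : ∀ t, Finset (Fin (p t)) → Measure (Fin (p t) → ℝ),
            (∀ t, ∀ S : Finset (Fin (p t)), S.card = s t →
              IsProbabilityMeasure (ν t S) ∧
                ∀ᵐ b ∂(ν t S), SparsityRecovery.supp b = S ∧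
                  M t ≤ SparsityRecovery.minAbs b) →
            Tendsto (fun t => SparsityRecovery.avgErrorProb (s t) (φ t) (ν t))
              atTop (𝓝 0)) := by
  have hL0 : 0 < Real.log (1 / α) :=
    Real.log_pos (by rw [one_div]; exact (one_lt_inv₀ hα0).2 hα1)
  refine ⟨1024 * (1 + 1 / Real.log (1 / α)), by positivity, ?_⟩
  intro n p s M hn hs hsp hM hnM hC φ hφ
  have hlim := SparsityRecovery.tendsto_explicit_errorBound (2 / (1 - α)) hn hnM
  have hbound := hC.mono fun t ht =>
    SparsityRecovery.errorBound_le_of_sample_size hα0 hα1 (hs t) (hsp t) (hM t) ht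
  refine ⟨fun β hβs hβM => ?_, fun ν hν => ?_⟩
  · refine squeeze_zero' (Eventually.of_forall fun t => measureReal_nonneg) ?_ hlim
    filter_upwards [hbound] with t ht
    exact (SparsityRecovery.errorProb_le (hφ t) (hM t) ht.1 (hβs t) (hβM t)).trans ht.2
  · refine squeeze_zero' (Eventually.of_forall fun t => ?_) ?_ hlim
    · exact mul_nonneg (by positivity) (Finset.sum_nonneg fun _ _ => measureReal_nonneg)
    · filter_upwards [hbound] with t ht
      exact (SparsityRecovery.avgErrorProb_le (hφ t) (hM t) ht.1 (ν t) (hν t)).trans ht.2
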